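/- Let $u\in\mathbb C$ be a primitive fifth root of unity and put $x=1$, $y=u^2+u^3$. Let $D$ be a diagram of an unoriented link in $S^2$; a diagram in the plane is regarded as a diagram in $S^2$, by adding a point at infinity to its unbounded face. (The diagram consists of finitely many closed curves, with or without crossings, given up to isotopy; it may be disconnected or empty.) The faces of $D$ are the connected components of its complement, and $\chi_f$ is the Euler characteristic of the face $f$. Call $D$ fine if all its faces are open disks. A state of $D$ gives each face one of the symbols white, black. It is forbidden if two adjacent faces (the faces on the two sides of some edge, or of some closed curve without crossings) are both black. Draw a crossing so that its overpass is the northeast-southwest strand, and read the symbols of its east, north, west and south corners in this order, with $0$ for white and $1$ for black. The weight of the crossing is $$-u^2-u^3\ \text{for } 0000,\quad -u^3\ \text{for } 0001, 0100,\quad -u^2\ \text{for } 0010, 1000,\quad u\ \text{for } 0101,\quad u^4\ \text{for } 1010,$$ and $0$ otherwise. A partial state is a relation that assigns zero or more symbols (dots) to each face. The value of the $u$-invariant on a partial state is the sum, over all states that extend it and are not forbidden, of the product of the weights of all crossings and of the factors $x^{\chi_f}$ (for $f$ white) or $y^{\chi_f}$ (for $f$ black) of all faces $f$ to which the partial state assigns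 no symbol. Let $V_D(f)$ be the value on the partial state that has exactly one dot, coloured black, in the face $f$. Then: (1) If $D$ is fine, $V_D(f)$ does not depend on the face $f$, that is, $V_D(f)=V_D(g)$ for all faces $f,g$ of $D$. (2) For every $D$, fine or not, $y^{\chi_f}V_D(f)=y^{\chi_g}V_D(g)$ for all faces $f,g$ of $D$; in other words, $V_D(f)$ does not depend on $f$ once the facial factor of the dotted face, which the convention for partial states leaves out, is put back. -/

import Mathlib

/-- Half-edges at the crossings: `(v, i)` is the `i`-th of the four half-edges at the crossing `v`.
They are numbered anticlockwise around `v`, with `v` drawn so that the overpass is the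
northeast-southwest strand: `0` = northeast, `1` = northwest, `2` = southwest, `3` = southeast.
So the half-edges `0` and `2` form the overpass, and `1` and `3` the underpass.

The same pairs also name the corners at the crossings: the corner `(v, i)` is the sector at `v`
that lies between the half-edges `i - 1` and `i`, so that the corners `0, 1, 2, 3` of `v` are
the east, north, west and south corners. -/
abbrev HalfEdge (V : Type*) : Type _ := V × Fin 4

/-- Rotation by one step anticlockwise around a crossing (`Fin 4` is cyclic). -/
def turn {V : Type*} (h : HalfEdge V) : HalfEdge V := (h.1, h.2 + 1)

/-- The combinatorial data of a diagram of an unoriented link, given up to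
isotopy, in an oriented surface: `V` is the set of crossings, `C` the set of closed curves
without crossings, and `F` the set of faces. -/
structure LinkDiagram (V C F : Type*) where
  /-- the other half of the edge that starts with a given half-edge -/
  opp : HalfEdge V → HalfEdge V
  opp_opp : ∀ h, opp (opp h) = h
  opp_ne : ∀ h, opp h ≠ h
  /-- the face that contains a given corner -/
  cornerFace : HalfEdge V → F
  /-- the faces on the two sides of a crossingless curve -/
  circleFace : C → Bool → F
  /-- An edge with halves `h` and `opp h` has the corners `h` and `turn (opp h)` on the same
  side. -/
  cornerFace_walk : ∀ h, cornerFace (turn (opp h)) = cornerFace h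

namespace LinkDiagram

variable {V C F : Type*} (D : LinkDiagram V C F)

/-- The boundary walks along edges and crossings: the cycles of corners met when one walks
along the edges, keeping a face on a fixed side. -/
def Walk : Type _ := Quot fun h k : HalfEdge V => k = turn (D.opp h)

/-- The face on whose boundary a walk lies. -/
def walkFace : D.Walk → F :=
  Quot.lift D.cornerFace (by rintro h _ rfl; exact (D.cornerFace_walk h).symm)

/-- The connected components of the diagram (as a subset of the surface) that contain
crossings. -/
def Piece : Type _ := Quot fun h k : HalfEdge V => k = turn h ∨ k = D.opp h

/-- Two faces are adjacent if they are the faces on the two sides of an edge or of a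
crossingless curve. -/
def Adj (f g : F) : Prop :=
  (∃ h, D.cornerFace h = f ∧ D.cornerFace (turn h) = g) ∨
    ∃ c b, D.circleFace c b = f ∧ D.circleFace c (!b) = g

/-- The diagram lies in the sphere, each face being a sphere minus disjoint closed disks,
one for each of its boundary curves. The diagram may be disconnected or empty.

`euler_pieces` is Euler's formula for the pieces with crossings, each put into a surface that
it cuts into disks: there are `#V` vertices, `2 * #V` edges and `#Walk` disks, so the total
Euler characteristic is `#Walk - #V`. It is at most `2` for each piece, with equality
exactly for the sphere. `connected` and `euler_faces` say that the incidence graph between the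
components of the diagram (`Piece` and `C`) and the faces (`F`), which has one edge for each
boundary curve (`Walk` and `C × Bool`), is a tree: it is connected, and the number of its
edges plus one is the number of its vertices. -/
structure IsSpherical : Prop where
  euler_pieces : Nat.card V + 2 * Nat.card D.Piece = Nat.card D.Walk
  connected : ∀ f g, Relation.ReflTransGen D.Adj f g
  euler_faces : (Nat.card D.Walk + 2 * Nat.card C) + 1 =
    (Nat.card D.Piece + Nat.card C) + Nat.card F

/-- The Euler characteristic of a face of a diagram in the sphere: two minus the number of its
boundary curves. -/
noncomputable def eulerChar (f : F) : ℤ :=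
  2 - (({w : D.Walk | D.walkFace w = f}.ncard : ℤ) +
    ({s : C × Bool | D.circleFace s.1 s.2 = f}.ncard : ℤ))

/-- A diagram in the sphere is fine if all its faces are open disks. (So it is nonempty
and connected.) -/
def IsFine : Prop := ∀ f, D.eulerChar f = 1

end LinkDiagram

/-- The value of the facial variable of a symbol (`false` = white, `true` = black). -/
def uFaceVar (u : ℂ) : Bool → ℂ
  | false => 1
  | true => u ^ 2 + u ^ 3

/-- The value of the crossing variable for the symbols (`true` = black) in the
east, north, west and south corners of a crossing, whose overpass is drawn
northeast-southwest. -/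
def uCrossingVar (u : ℂ) : Bool → Bool → Bool → Bool → ℂ
  | false, false, false, false => -u ^ 2 - u ^ 3
  | false, false, false, true => -u ^ 3
  | false, true, false, false => -u ^ 3
  | false, false, true, false => -u ^ 2
  | true, false, false, false => -u ^ 2
  | false, true, false, true => u
  | true, false, true, false => u ^ 4
  | _, _, _, _ => 0

namespace LinkDiagram

variable {V C F : Type*} (D : LinkDiagram V C F)

/-- A state (`true` = black) is forbidden if it has adjacent faces that are both black. -/
def Forbidden (σ : F → Bool) : Prop := ∃ f g, D.Adj f g ∧ σ f = true ∧ σ g = true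

open Classical in
/-- The value of the `u`-invariant on a partial state `ρ`, that is, a relation that assigns zero or
more symbols to each face. It is the sum over all states that extend `ρ` and
are not forbidden. A face `f` with symbol `i` contributes the facial variable of `i` to the power
`eulerChar f`, except that the faces to which `ρ` has assigned a symbol contribute nothing. -/
noncomputable def uValue [Fintype V] [Fintype F] (u : ℂ) (ρ : F → Bool → Prop) : ℂ :=
  ∑ σ : F → Bool with (∀ f s, ρ f s → σ f = s) ∧ ¬ D.Forbidden σ,
    (∏ f : F with ¬ ∃ s, ρ f s, uFaceVar u (σ f) ^ D.eulerChar f) *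
      ∏ v : V, uCrossingVar u (σ (D.cornerFace (v, 0))) (σ (D.cornerFace (v, 1)))
        (σ (D.cornerFace (v, 2))) (σ (D.cornerFace (v, 3)))

end LinkDiagram

/-- The partial state that has exactly one dot, coloured black, in the face `f`. -/
def blackDot {F : Type*} (f : F) : F → Bool → Prop := fun g s => g = f ∧ s = true

/-! On a state that is not forbidden, every crossing weight splits into two smoothings with
coefficients `-u ^ 3` and `-u ^ 2` (`uCrossingVar_eq_smoothings`). A smoothing joins two opposite
corners by a band: the two faces must then have the same colour, and the band has Euler
characteristic `-1`, hence the factor `y⁻¹` or `1`. So, with the facial factor put back, the value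
is a sum over complete smoothings (`facial_mul_uValue_eq_sum`), and it suffices to treat each
smoothing separately.

A complete smoothing consists of disjoint closed curves. Its regions are the vertices and its curves
the edges of a graph, which in the sphere is a tree. A region with `k` boundary curves has weight `Y
^ (2 - k)`, that is, `Y ^ 2` at the vertex and `Y⁻¹` at each edge end. Because `y ^ 2 + y = 1`,
summing over the colour of a leaf gives the factor `y⁻¹`, whatever the colour of its neighbour.
Pruning the tree down to the black root leaves `y ^ 2` times `y⁻¹` for each curve, whichever region
is the root. (The total is `y ^ 2` times a Kauffman bracket with loop value `y⁻¹`.)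

That the graph is a tree is shown by counting (`exists_setoid_of_bands`, `sum_independent_sets`).
Adding the bands one by one shows that a region has Euler characteristic at most `2` minus its
number of boundary curves. These characteristics sum to `2`, so there are at most `#R - 1` curves
for `#R` regions; connectedness requires at least as many. Sphericity enters only through this sum
and through connectedness. -/

/-! ### Counting the classes of an equivalence relation. -/

/-- The equivalence relation obtained from `s` by identifying `a` and `b`. -/
def Setoid.glue {α : Type*} (s : Setoid α) (a b : α) : Setoid α where
  r x y := s x y ∨ (s x a ∧ s b y) ∨ (s x b ∧ s a y)
  iseqv :=
    { refl := fun x => Or.inl (s.refl x)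
      symm := by
        rintro x y (h | ⟨h, k⟩ | ⟨h, k⟩)
        · exact Or.inl (s.symm h)
        · exact Or.inr (Or.inr ⟨s.symm k, s.symm h⟩)
        · exact Or.inr (Or.inl ⟨s.symm k, s.symm h⟩)
      trans := by
        have t : ∀ {x y z}, s x y → s y z → s x z := fun h k => s.trans h k
        have r : ∀ {x y}, s x y → s y x := fun h => s.symm h
        rintro x y z (h | ⟨h, k⟩ | ⟨h, k⟩) (h' | ⟨h', k'⟩ | ⟨h', k'⟩)
        · exact Or.inl (t h h')
        · exact Or.inr (Or.inl ⟨t h h', k'⟩)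
        · exact Or.inr (Or.inr ⟨t h h', k'⟩)
        · exact Or.inr (Or.inl ⟨h, t k h'⟩)
        · exact Or.inr (Or.inl ⟨h, k'⟩)
        · exact Or.inl (t h k')
        · exact Or.inr (Or.inr ⟨h, t k h'⟩)
        · exact Or.inl (t h k')
        · exact Or.inr (Or.inr ⟨h, k'⟩) }

theorem Setoid.glue_apply {α : Type*} (s : Setoid α) (a b x y : α) :
    s.glue a b x y ↔ s x y ∨ (s x a ∧ s b y) ∨ (s x b ∧ s a y) := Iff.rfl

theorem Setoid.le_glue {α : Type*} (s : Setoid α) (a b : α) : s ≤ s.glue a b :=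
  fun _ _ h => Or.inl h

theorem Setoid.glue_pair {α : Type*} (s : Setoid α) (a b : α) : s.glue a b a b :=
  Or.inr (Or.inl ⟨s.refl a, s.refl b⟩)

theorem Setoid.glue_le {α : Type*} {s t : Setoid α} {a b : α} (h : s ≤ t) (hab : t a b) :
    s.glue a b ≤ t := by
  rintro x y (k | ⟨k, k'⟩ | ⟨k, k'⟩)
  · exact h k
  · exact t.trans (h k) (t.trans hab (h k'))
  · exact t.trans (h k) (t.trans (t.symm hab) (h k'))

/-- The number of classes of `s` that meet `Y`. -/
noncomputable def Setoid.numClasses {α : Type*} (s : Setoid α) (Y : Set α) : ℕ :=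
  (Quotient.mk s '' Y).ncard

/-- Representatives in `Y` of the `t`-classes, one for each, are pairwise inequivalent under `s` as
well. -/
theorem Setoid.numClasses_mono_on {α : Type*} [Finite α] {s t : Setoid α} {Y : Set α}
    (h : ∀ x ∈ Y, ∀ y ∈ Y, s x y → t x y) : t.numClasses Y ≤ s.numClasses Y := by
  obtain ⟨Z, hZ, hb⟩ := Set.exists_subset_bijOn Y (Quotient.mk t)
  unfold Setoid.numClasses
  rw [← hb.image_eq, hb.injOn.ncard_image]
  have hinj : Set.InjOn (Quotient.mk s) Z := fun x hx y hy hxy =>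
    hb.injOn hx hy (Quotient.sound (h x (hZ hx) y (hZ hy) (Quotient.exact hxy)))
  rw [← hinj.ncard_image]
  exact Set.ncard_le_ncard (Set.image_mono hZ) (Set.toFinite _)

theorem Setoid.numClasses_mono {α : Type*} [Finite α] {s t : Setoid α} (h : s ≤ t) (Y : Set α) :
    t.numClasses Y ≤ s.numClasses Y :=
  Setoid.numClasses_mono_on fun _ _ _ _ k => h k

theorem Setoid.numClasses_union_le {α : Type*} (s : Setoid α) (Y Z : Set α) :
    s.numClasses (Y ∪ Z) ≤ s.numClasses Y + s.numClasses Z := by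
  unfold Setoid.numClasses
  rw [Set.image_union]
  exact Set.ncard_union_le _ _

/-- The map between the quotients is injective away from the class of `a`. -/
theorem Setoid.numClasses_le_glue {α : Type*} [Finite α] (s : Setoid α) (a b : α) (Y : Set α) :
    s.numClasses Y ≤ (s.glue a b).numClasses Y + 1 := by
  unfold Setoid.numClasses
  set q : Quotient s → Quotient (s.glue a b) :=
    Quotient.map id (fun _ _ k => s.le_glue a b k) with hq
  have him : Quotient.mk (s.glue a b) '' Y = q '' (Quotient.mk s '' Y) := by
    rw [Set.image_image]; rfl
  have hinj : Set.InjOn q ((Quotient.mk s '' Y) \ {Quotient.mk s a}) := by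
    rintro x ⟨-, hx⟩ y ⟨-, hy⟩ hxy
    induction x using Quotient.inductionOn
    induction y using Quotient.inductionOn
    rename_i x y
    rcases Quotient.exact hxy with k | ⟨k, k'⟩ | ⟨k, k'⟩
    · exact Quotient.sound k
    · exact absurd (Quotient.sound k) hx
    · exact absurd (Quotient.sound (s.symm k')) hy
  have h1 := hinj.ncard_image
  have h2 : (q '' ((Quotient.mk s '' Y) \ {Quotient.mk s a})).ncard ≤
      (Quotient.mk (s.glue a b) '' Y).ncard := by
    rw [him]; exact Set.ncard_le_ncard (Set.image_mono Set.sdiff_subset) (Set.toFinite _)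
  have h3 := Set.ncard_le_ncard_sdiff_add_ncard (Quotient.mk s '' Y) {Quotient.mk s a}
    (Set.toFinite _)
  rw [Set.ncard_singleton] at h3
  omega

theorem Setoid.numClasses_glue_lt {α : Type*} [Finite α] (s : Setoid α) {a b : α} {Y : Set α}
    (ha : a ∈ Y) (hb : b ∈ Y) (hab : ¬ s a b) :
    (s.glue a b).numClasses Y + 1 ≤ s.numClasses Y := by
  unfold Setoid.numClasses
  set q : Quotient s → Quotient (s.glue a b) :=
    Quotient.map id (fun _ _ k => s.le_glue a b k) with hq
  have him : Quotient.mk (s.glue a b) '' Y ⊆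
      q '' ((Quotient.mk s '' Y) \ {Quotient.mk s a}) := by
    rintro _ ⟨y, hy, rfl⟩
    by_cases h : s y a
    · refine ⟨Quotient.mk s b, ⟨⟨b, hb, rfl⟩, fun k => hab (s.symm (Quotient.exact k))⟩, ?_⟩
      exact Quotient.sound (Or.inr (Or.inr ⟨s.refl b, s.symm h⟩))
    · exact ⟨Quotient.mk s y, ⟨⟨y, hy, rfl⟩, fun k => h (Quotient.exact k)⟩, rfl⟩
  have h1 := Set.ncard_le_ncard him (Set.toFinite _)
  have h2 := Set.ncard_image_le (f := q)
    (Set.toFinite ((Quotient.mk s '' Y) \ {Quotient.mk s a}))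
  have h3 := Set.ncard_sdiff_singleton_add_one (s := Quotient.mk s '' Y)
    (a := Quotient.mk s a) ⟨a, ha, rfl⟩ (Set.toFinite _)
  omega

/-! ### Cycles of a permutation multiplied by a transposition. -/

namespace Equiv.Perm

theorem sameCycle_swap_mul_apply {α : Type*} [DecidableEq α] (φ : Perm α) (a b x : α) :
    (SameCycle.setoid (swap a b * φ)).glue a b x (φ x) := by
  have h1 : SameCycle (swap a b * φ) x ((swap a b * φ) x) := ⟨1, by simp⟩
  rw [mul_apply] at h1
  by_cases ha : φ x = a
  · rw [ha, swap_apply_left] at h1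
    rw [ha]; exact Or.inr (Or.inr ⟨h1, SameCycle.refl _ _⟩)
  by_cases hb : φ x = b
  · rw [hb, swap_apply_right] at h1
    rw [hb]; exact Or.inr (Or.inl ⟨h1, SameCycle.refl _ _⟩)
  · rw [swap_apply_of_ne_of_ne ha hb] at h1
    exact Or.inl h1

theorem SameCycle.setoid_le {α : Type*} {φ : Perm α} {s : Setoid α} (h : ∀ x, s x (φ x)) :
    SameCycle.setoid φ ≤ s := by
  have hn : ∀ (n : ℕ) x, s x ((φ ^ n) x) := by
    intro n
    induction n with
    | zero => intro x; exact s.refl x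
    | succ n ih =>
      intro x
      rw [pow_succ', mul_apply]
      exact s.trans (ih x) (h _)
  rintro x y ⟨k, rfl⟩
  obtain ⟨n, rfl | rfl⟩ := k.eq_nat_or_neg
  · simpa using hn n x
  · have := hn n ((φ ^ (-(n : ℤ))) x)
    rw [← mul_apply, zpow_neg, zpow_natCast, mul_inv_cancel, one_apply] at this
    rw [zpow_neg, zpow_natCast]
    exact s.symm this

/-- One step of `φ` differs from one step of `swap a b * φ` at most by exchanging `a` and `b`, which
gluing makes invisible. The converse follows since multiplication by the transposition is an
involution. -/
theorem setoid_swap_mul_glue {α : Type*} [DecidableEq α] (φ : Perm α) (a b : α) :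
    (SameCycle.setoid (swap a b * φ)).glue a b = (SameCycle.setoid φ).glue a b := by
  have key : ∀ ψ : Perm α, (SameCycle.setoid ψ).glue a b ≤
      (SameCycle.setoid (swap a b * ψ)).glue a b := fun ψ =>
    Setoid.glue_le (SameCycle.setoid_le (sameCycle_swap_mul_apply ψ a b)) (Setoid.glue_pair _ _ _)
  refine le_antisymm ?_ (key φ)
  have := key (swap a b * φ)
  rwa [swap_mul_self_mul] at this

theorem sameCycle_swap_mul {α : Type*} [Finite α] [DecidableEq α] {φ : Perm α} {a b : α}
    (h : ¬ SameCycle φ a b) : SameCycle (swap a b * φ) a b := by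
  classical
  have hex : ∃ n : ℕ, (φ ^ (n + 1)) a = a := by
    refine ⟨orderOf φ - 1, ?_⟩
    rw [Nat.sub_add_cancel (orderOf_pos φ), pow_orderOf_eq_one, one_apply]
  -- Up to the first return of `a` under `φ`, the orbit meets neither `a` again nor `b`, so the
  -- transposition does not act. At the return it sends `a` to `b`.
  have hmin : ∀ k ≤ Nat.find hex, ((swap a b * φ) ^ k) a = (φ ^ k) a := by
    intro k
    induction k with
    | zero => intro _; rfl
    | succ k ih =>
      intro hk
      rw [pow_succ', mul_apply, ih (by omega), mul_apply, ← mul_apply φ, ← pow_succ',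
        swap_apply_of_ne_of_ne]
      · exact Nat.find_min hex (by omega)
      · rintro hb
        exact h ⟨(k + 1 : ℕ), by rw [zpow_natCast]; exact hb⟩
  refine ⟨(Nat.find hex + 1 : ℕ), ?_⟩
  rw [zpow_natCast, pow_succ', mul_apply, hmin _ le_rfl, mul_apply, ← mul_apply φ, ← pow_succ',
    Nat.find_spec hex, swap_apply_left]

theorem numClasses_swap_mul_le {α : Type*} [Finite α] [DecidableEq α] (φ : Perm α) (a b : α)
    (Y : Set α) : (SameCycle.setoid (swap a b * φ)).numClasses Y ≤
      (SameCycle.setoid φ).numClasses Y + 1 := by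
  have h1 := (SameCycle.setoid (swap a b * φ)).numClasses_le_glue a b Y
  rw [setoid_swap_mul_glue] at h1
  have h2 := Setoid.numClasses_mono ((SameCycle.setoid φ).le_glue a b) Y
  omega

theorem numClasses_swap_mul_lt {α : Type*} [Finite α] [DecidableEq α] {φ : Perm α} {a b : α}
    {Y : Set α} (ha : a ∈ Y) (hb : b ∈ Y) (hab : ¬ SameCycle φ a b) :
    (SameCycle.setoid (swap a b * φ)).numClasses Y + 1 ≤ (SameCycle.setoid φ).numClasses Y := by
  have h1 := (SameCycle.setoid φ).numClasses_glue_lt ha hb hab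
  have h2 := Setoid.numClasses_mono (Setoid.glue_le (le_refl (SameCycle.setoid (swap a b * φ)))
    (sameCycle_swap_mul hab)) Y
  rw [setoid_swap_mul_glue] at h2
  omega

/-- For regions that the new band does not touch. -/
theorem numClasses_le_of_eqOn {α : Type*} [Finite α] {φ ψ : Perm α} {Y : Set α}
    (hY : ∀ x, φ x ∈ Y ↔ x ∈ Y) (h : ∀ x ∈ Y, ψ x = φ x) :
    (SameCycle.setoid ψ).numClasses Y ≤ (SameCycle.setoid φ).numClasses Y := by
  -- The relation is the cycle relation of `ψ` inside `Y` and relates everything outside, so that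
  -- one step of `φ` respects it everywhere.
  let s : Setoid α :=
    { r := fun x y => (x ∈ Y ↔ y ∈ Y) ∧ (x ∈ Y → SameCycle ψ x y)
      iseqv :=
        { refl := fun x => ⟨Iff.rfl, fun _ => SameCycle.refl _ _⟩
          symm := fun h => ⟨h.1.symm, fun k => (h.2 (h.1.2 k)).symm⟩
          trans := fun h k => ⟨h.1.trans k.1, fun l => (h.2 l).trans (k.2 (h.1.1 l))⟩ } }
  have hs : SameCycle.setoid φ ≤ s :=
    SameCycle.setoid_le fun x => ⟨(hY x).symm, fun hx => ⟨1, by simpa using h x hx⟩⟩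
  exact Setoid.numClasses_mono_on fun x hx y _ k => (hs k).2 hx

/-- The two sides of a curve are different cycles. As `ι` reverses `ψ`, it would act on a common
cycle as a reflection. This has a fixed point if `n = 2 * k`, and exchanges two successive points if
`n = 2 * k + 1`; both are excluded. -/
theorem not_sameCycle_of_involution {α : Type*} {ι ψ : Perm α} (hι : ∀ x, ι x ≠ x)
    (hψι : ∀ x, ψ x ≠ ι x) (h : ι * ψ * ι⁻¹ = ψ⁻¹) (x : α) : ¬ SameCycle ψ x (ι x) := by
  have hk : ∀ (k : ℤ) y, ι ((ψ ^ k) y) = (ψ ^ (-k)) (ι y) := by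
    intro k y
    have := conj_zpow (i := k) (a := ι) (b := ψ)
    rw [h, inv_zpow, ← zpow_neg] at this
    rw [this]; simp
  rintro ⟨n, hn⟩
  obtain ⟨k, rfl | rfl⟩ := n.even_or_odd'
  · apply hι ((ψ ^ k) x)
    rw [hk, ← hn, ← mul_apply, ← zpow_add]
    congr 2; ring
  · apply hψι ((ψ ^ k) x)
    rw [hk, ← hn, ← mul_apply, ← mul_apply, ← zpow_add, ← zpow_one_add]
    congr 2; ring

end Equiv.Perm

/-! ### Euler characteristics of faces joined by bands. -/

open Classical in
/-- The boundary curves of the regions that arise when the faces in `F` are joined by bands. `M`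
holds the marked points on the boundary curves of the faces, `Φ` permutes them along these curves,
and for `v ∈ S` a band joins the marked points `a v` and `b v`. -/
theorem exists_setoid_of_bands {V M F : Type*} [Finite M] [Fintype F] {Φ : Equiv.Perm M}
    {c : M → F} (hc : ∀ m, c (Φ m) = c m) {a b : V → M}
    (hne : ∀ v w, v ≠ w → a v ≠ a w ∧ a v ≠ b w ∧ b v ≠ b w) (χ : F → ℤ)
    (hχ : ∀ f, χ f = 2 - ((Equiv.Perm.SameCycle.setoid Φ).numClasses (c ⁻¹' {f}) : ℤ))
    (S : Finset V) : ∀ τ : Equiv.Perm M, (∀ v ∈ S, τ (a v) = b v ∧ τ (b v) = a v) →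
      (∀ m, (∀ v ∈ S, m ≠ a v ∧ m ≠ b v) → τ m = m) →
      ∃ s : Setoid F, (∀ v ∈ S, s (c (a v)) (c (b v))) ∧
        (∀ σ : F → Bool, (∀ v ∈ S, σ (c (a v)) = σ (c (b v))) → ∀ f g, s f g → σ f = σ g) ∧
        (∀ m, s (c (τ m)) (c m)) ∧
        ∀ f₀, ∑ f with s f f₀, χ f - ((S.filter fun v => s (c (a v)) f₀).card : ℤ) +
          (Equiv.Perm.SameCycle.setoid (τ * Φ)).numClasses (c ⁻¹' {f | s f f₀}) ≤ 2 := by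
  induction S using Finset.induction with
  | empty =>
    intro τ _ hτ
    obtain rfl : τ = 1 := Equiv.ext fun m => hτ m (by simp)
    refine ⟨⊥, by simp, ?_, fun m => rfl, fun f₀ => ?_⟩
    · rintro σ - f g rfl; rfl
    · have h1 : (Finset.univ.filter fun f => (⊥ : Setoid F) f f₀) = {f₀} := by
        ext f; simp
      have h2 : {f | (⊥ : Setoid F) f f₀} = {f₀} := by
        ext f; simp
      rw [h1, h2, Finset.sum_singleton, hχ]
      simp
  | insert v S hv ih =>
    intro τ hτ hτ'
    -- `τ` is a product of disjoint transpositions, one for each band; `τ₀` omits the band `v`.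
    set τ₀ : Equiv.Perm M := Equiv.swap (a v) (b v) * τ with hτ₀
    have hττ : τ = Equiv.swap (a v) (b v) * τ₀ := by rw [hτ₀, Equiv.swap_mul_self_mul]
    obtain ⟨s, hs1, hs2, hs3, hs4⟩ := ih τ₀
      (by
        intro w hw
        have hwv : w ≠ v := by rintro rfl; exact hv hw
        obtain ⟨h1, h2⟩ := hτ w (Finset.mem_insert_of_mem hw)
        obtain ⟨k1, k2, k3⟩ := hne w v hwv
        obtain ⟨-, k4, -⟩ := hne v w hwv.symm
        simp only [hτ₀, Equiv.Perm.mul_apply, h1, h2]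
        exact ⟨Equiv.swap_apply_of_ne_of_ne k4.symm k3, Equiv.swap_apply_of_ne_of_ne k1 k2⟩)
      (by
        intro m hm
        obtain ⟨h1, h2⟩ := hτ v (Finset.mem_insert_self v S)
        rw [hτ₀, Equiv.Perm.mul_apply]
        by_cases ha : m = a v
        · rw [ha, h1, Equiv.swap_apply_right]
        by_cases hb : m = b v
        · rw [hb, h2, Equiv.swap_apply_left]
        have : τ m = m := hτ' m (by
          intro w hw
          rcases Finset.mem_insert.1 hw with rfl | hw
          · exact ⟨ha, hb⟩
          · exact hm w hw)
        rw [this, Equiv.swap_apply_of_ne_of_ne ha hb])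
    have hψ : τ * Φ = Equiv.swap (a v) (b v) * (τ₀ * Φ) := by rw [hττ, mul_assoc]
    have hsc : ∀ x y, Equiv.Perm.SameCycle (τ₀ * Φ) x y → s (c x) (c y) := by
      have : Equiv.Perm.SameCycle.setoid (τ₀ * Φ) ≤ s.comap c :=
        Equiv.Perm.SameCycle.setoid_le fun x => by
          rw [Setoid.comap_rel, Equiv.Perm.mul_apply]
          have := hs3 (Φ x)
          rw [hc] at this
          exact s.symm this
      exact fun x y h => this h
    have hrs : ∀ {x y}, s x y → s y x := fun h => s.symm h
    have hts : ∀ {x y z}, s x y → s y z → s x z := fun h k => s.trans h k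
    refine ⟨s.glue (c (a v)) (c (b v)), ?_, ?_, ?_, ?_⟩
    · intro w hw
      rcases Finset.mem_insert.1 hw with rfl | hw
      · exact s.glue_pair _ _
      · exact s.le_glue _ _ (hs1 w hw)
    · intro σ hσ f g hfg
      have h0 := hs2 σ fun w hw => hσ w (Finset.mem_insert_of_mem hw)
      have h1 := hσ v (Finset.mem_insert_self v S)
      rcases hfg with h | ⟨h, k⟩ | ⟨h, k⟩
      · exact h0 _ _ h
      · rw [h0 _ _ h, h1, h0 _ _ k]
      · rw [h0 _ _ h, ← h1, h0 _ _ k]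
    · intro m
      obtain ⟨h1, h2⟩ := hτ v (Finset.mem_insert_self v S)
      by_cases ha : m = a v
      · rw [ha, h1]; exact (s.glue _ _).symm (s.glue_pair _ _)
      by_cases hb : m = b v
      · rw [hb, h2]; exact s.glue_pair _ _
      have h3 := hs3 m
      rw [hτ₀, Equiv.Perm.mul_apply, Equiv.swap_apply_of_ne_of_ne] at h3
      · exact s.le_glue _ _ h3
      · exact fun h => hb (τ.injective (h.trans h2.symm))
      · exact fun h => ha (τ.injective (h.trans h1.symm))
    · intro f₀
      set s' := s.glue (c (a v)) (c (b v)) with hs'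
      by_cases hA : s' (c (a v)) f₀
      · have hband : (((insert v S).filter fun w => s' (c (a w)) f₀).card : ℤ) =
            (S.filter fun w => s' (c (a w)) f₀).card + 1 := by
          rw [Finset.filter_insert, if_pos hA, Finset.card_insert_of_notMem
            (fun h => hv (Finset.mem_filter.1 h).1)]
          push_cast; rfl
        rw [hband]
        -- If the band stays within one region, the Euler characteristic drops by one and the number
        -- of boundary curves grows by at most one. Only an inequality is available here, since the
        -- band may also join two boundary curves.
        by_cases hB : s (c (a v)) (c (b v))
        · have heq : s' = s := le_antisymm (Setoid.glue_le le_rfl hB) (s.le_glue _ _)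
          rw [heq]
          have h1 := hs4 f₀
          have h2 := Equiv.Perm.numClasses_swap_mul_le (τ₀ * Φ) (a v) (b v)
            (c ⁻¹' {f | s f f₀})
          rw [← hψ] at h2
          zify at h2
          linarith
        -- If the band joins two regions, it merges two boundary curves, because a curve lies in a
        -- single region. The bound becomes `2 + 2 - 1 - 1 = 2`.
        · have heq : ∀ f, s' f f₀ ↔ s f (c (a v)) ∨ s f (c (b v)) := by
            intro f
            have : s' f f₀ ↔ s' f (c (a v)) :=
              ⟨fun h => s'.trans h (s'.symm hA), fun h => s'.trans h hA⟩
            rw [this, hs', Setoid.glue_apply]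
            constructor
            · rintro (h | h | h)
              · exact Or.inl h
              · exact Or.inl h.1
              · exact Or.inr h.1
            · rintro (h | h)
              · exact Or.inl h
              · exact Or.inr (Or.inr ⟨h, s.refl _⟩)
          have hdisj : ∀ f, s f (c (a v)) → ¬ s f (c (b v)) :=
            fun f h k => hB (hts (hrs h) k)
          have hset : c ⁻¹' {f | s' f f₀} =
              c ⁻¹' {f | s f (c (a v))} ∪ c ⁻¹' {f | s f (c (b v))} := by
            ext m; simp [heq]
          simp only [heq]
          rw [Finset.filter_or, Finset.filter_or,
            Finset.sum_union (Finset.disjoint_filter.2 fun f _ => hdisj f),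
            Finset.card_union_of_disjoint (Finset.disjoint_filter.2 fun f _ => hdisj _)]
          have h1 := hs4 (c (a v))
          have h2 := hs4 (c (b v))
          have h3 := Equiv.Perm.numClasses_swap_mul_lt (φ := τ₀ * Φ) (a := a v) (b := b v)
            (Y := c ⁻¹' {f | s' f f₀}) hA (s'.trans (s'.symm (s.glue_pair _ _)) hA)
            (fun h => hB (hsc _ _ h))
          rw [← hψ, hset] at h3
          have h4 := (Equiv.Perm.SameCycle.setoid (τ₀ * Φ)).numClasses_union_le
            (c ⁻¹' {f | s f (c (a v))}) (c ⁻¹' {f | s f (c (b v))})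
          have h5 : {f | s f (c (a v)) ∨ s f (c (b v))} =
            {f | s f (c (a v))} ∪ {f | s f (c (b v))} := rfl
          rw [h5, Set.preimage_union]
          zify at h3 h4
          push_cast
          linarith
      · have hA' : ¬ s' (c (b v)) f₀ := fun h => hA (s'.trans (s.glue_pair _ _) h)
        have heq : ∀ f, s' f f₀ ↔ s f f₀ := by
          intro f
          refine ⟨?_, fun h => s.le_glue _ _ h⟩
          rintro (h | ⟨-, h⟩ | ⟨-, h⟩)
          · exact h
          · exact absurd (s.le_glue _ _ h) hA'
          · exact absurd (s.le_glue _ _ h) hA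
        simp only [heq] at hA hA' ⊢
        rw [Finset.filter_insert, if_neg hA]
        have h1 := hs4 f₀
        have hY : ∀ x, (τ₀ * Φ) x ∈ c ⁻¹' {f | s f f₀} ↔ x ∈ c ⁻¹' {f | s f f₀} := by
          intro x
          have := hsc x ((τ₀ * Φ) x) ⟨1, by simp⟩
          exact ⟨fun h => hts this h, fun h => hts (hrs this) h⟩
        have h2 := Equiv.Perm.numClasses_le_of_eqOn (ψ := τ * Φ) hY (by
          intro x hx
          rw [hψ, Equiv.Perm.mul_apply, Equiv.swap_apply_of_ne_of_ne]
          · intro h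
            have := (hY x).2 hx
            rw [h] at this
            exact hA this
          · intro h
            have := (hY x).2 hx
            rw [h] at this
            exact hA' this)
        zify at h2
        linarith

/-! ### Spanning trees and sums over colourings. -/

/-- Subtrees with root `r₀` of the graph with vertex set `R` in which `b : B` is an end at
`reg b` of an edge, whose other end is `ι b`. A subtree is given by its vertices and one end of
each of its edges. -/
inductive IsSubtree {B R : Type*} [DecidableEq B] [DecidableEq R] (ι : B → B) (reg : B → R)
    (r₀ : R) : Finset R → Finset B → Prop
  | root : IsSubtree ι reg r₀ {r₀} ∅
  | grow {A T b} : IsSubtree ι reg r₀ A T → reg b ∈ A → reg (ι b) ∉ A →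
      IsSubtree ι reg r₀ (insert (reg (ι b)) A) (insert b T)

namespace IsSubtree

variable {B R : Type*} [DecidableEq B] [DecidableEq R] {ι : B → B} {reg : B → R} {r₀ : R}
  {A : Finset R} {T : Finset B}

theorem root_mem (h : IsSubtree ι reg r₀ A T) : r₀ ∈ A := by
  induction h with
  | root => simp
  | grow _ _ _ ih => exact Finset.mem_insert_of_mem ih

theorem reg_mem (h : IsSubtree ι reg r₀ A T) : ∀ b ∈ T, reg b ∈ A ∧ reg (ι b) ∈ A := by
  induction h with
  | root => simp
  | grow _ hb _ ih =>
    intro x hx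
    rcases Finset.mem_insert.1 hx with rfl | hx
    · exact ⟨Finset.mem_insert_of_mem hb, Finset.mem_insert_self _ _⟩
    · exact ⟨Finset.mem_insert_of_mem (ih x hx).1, Finset.mem_insert_of_mem (ih x hx).2⟩

theorem card_eq (h : IsSubtree ι reg r₀ A T) : A.card = T.card + 1 := by
  induction h with
  | root => simp
  | grow h _ hb ih =>
    rw [Finset.card_insert_of_notMem hb, Finset.card_insert_of_notMem, ih]
    exact fun k => hb (h.reg_mem _ k).2

/-- An edge is added only when its far end is new, so it cannot be added a second time from its
other end. -/
theorem invol_notMem (hι : ∀ b, ι (ι b) = b) (hne : ∀ b, ι b ≠ b) (h : IsSubtree ι reg r₀ A T) :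
    ∀ b ∈ T, ι b ∉ T := by
  induction h with
  | root => simp
  | @grow A T b h _ hb ih =>
    intro x hx k
    rcases Finset.mem_insert.1 hx with rfl | hx <;> rcases Finset.mem_insert.1 k with k | k
    · exact hne _ k
    · exact hb (h.reg_mem _ k).1
    · rw [← k, hι] at hb
      exact hb (h.reg_mem _ hx).1
    · exact ih x hx k

theorem disjoint_image (hι : ∀ b, ι (ι b) = b) (hne : ∀ b, ι b ≠ b)
    (h : IsSubtree ι reg r₀ A T) : Disjoint T (T.image ι) := by
  rw [Finset.disjoint_left]
  intro b hb k
  obtain ⟨x, hx, rfl⟩ := Finset.mem_image.1 k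
  exact h.invol_notMem hι hne x hx hb

theorem exists_univ [Fintype R]
    (hconn : ∀ r r', Relation.ReflTransGen (fun x y => ∃ b, reg b = x ∧ reg (ι b) = y) r r')
    (r₀ : R) : ∃ T, IsSubtree ι reg r₀ Finset.univ T := by
  suffices H : ∀ n, ∀ A T, IsSubtree ι reg r₀ A T → Fintype.card R - A.card = n →
      ∃ T, IsSubtree ι reg r₀ Finset.univ T from H _ _ _ root rfl
  intro n
  induction n with
  | zero =>
    intro A T h hn
    have : A = Finset.univ := by
      rw [← Finset.card_eq_iff_eq_univ]
      have := A.card_le_univ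
      omega
    exact ⟨T, this ▸ h⟩
  | succ n ih =>
    intro A T h hn
    have hex : ∃ r', r' ∉ A := by
      by_contra! hall
      rw [Finset.eq_univ_of_forall hall, Finset.card_univ] at hn
      omega
    obtain ⟨r', hr'⟩ := hex
    have hstep : ∃ b, reg b ∈ A ∧ reg (ι b) ∉ A := by
      by_contra! hall
      apply hr'
      have := hconn r₀ r'
      clear hr'
      induction this with
      | refl => exact h.root_mem
      | tail _ hb ih =>
        obtain ⟨b, rfl, rfl⟩ := hb
        exact hall b ih
    obtain ⟨b, hb, hb'⟩ := hstep
    refine ih _ _ (h.grow hb hb') ?_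
    rw [Finset.card_insert_of_notMem hb']
    omega

/-- A sum over all colourings of the vertices, with a weight for each vertex and edge of a
subtree: if the edge weights are stochastic up to the factor `d`, then the leaves can be
summed away. -/
theorem sum_colourings [Fintype R] {w : Bool → ℂ} {m : Bool → Bool → ℂ} {d : ℂ}
    (hm : ∀ i, w true * m i true + w false * m i false = d) (h : IsSubtree ι reg r₀ A T) :
    2 ^ A.card * ∑ σ : R → Bool, (if σ r₀ = true then 1 else 0) *
      ((∏ r ∈ A, w (σ r)) * ∏ b ∈ T, m (σ (reg b)) (σ (reg (ι b)))) =
    2 ^ Fintype.card R * (w true * d ^ T.card) := by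
  -- Adding to each colouring its flip at `r` isolates the two colours of `r` without splitting the
  -- function space. The powers of `2` in the statement absorb this doubling and the free colours
  -- outside `A`.
  have flip : ∀ (r : R) (G : (R → Bool) → ℂ),
      2 * ∑ σ, G σ = ∑ σ, (G (Function.update σ r true) + G (Function.update σ r false)) := by
    intro r G
    have hflip : ∑ σ, G σ = ∑ σ, G (Function.update σ r (!σ r)) :=
      (Equiv.sum_comp (Function.Involutive.toPerm
        (fun σ : R → Bool => Function.update σ r (!σ r)) (fun σ => by simp)) G).symm
    rw [two_mul]
    nth_rewrite 2 [hflip]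
    rw [← Finset.sum_add_distrib]
    refine Finset.sum_congr rfl fun σ _ => ?_
    have h0 : Function.update σ r (σ r) = σ := Function.update_eq_self r σ
    cases hσ : σ r
    · rw [hσ] at h0
      rw [h0, Bool.not_false, add_comm]
    · rw [hσ] at h0
      rw [h0, Bool.not_true]
  induction h with
  | root =>
    rw [Finset.card_singleton, pow_one, flip r₀]
    simp
  | @grow A T b h hb hb' ih =>
    have hbT : b ∉ T := fun k => hb' (h.reg_mem _ k).2
    have hr : ∀ x ∈ A, x ≠ reg (ι b) := by rintro x hx rfl; exact hb' hx
    rw [Finset.card_insert_of_notMem hb', Finset.card_insert_of_notMem hbT, pow_succ, mul_assoc,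
      flip (reg (ι b)), pow_succ (M := ℂ) d, ← mul_assoc (w true), ← mul_assoc, ← ih, mul_assoc,
      Finset.sum_mul]
    -- The new leaf occurs only in its own vertex weight and in the weight of the new edge, so `hm`
    -- sums it away.
    congr 1
    refine Finset.sum_congr rfl fun σ _ => ?_
    have hA : ∀ i, ∏ r ∈ A, w (Function.update σ (reg (ι b)) i r) = ∏ r ∈ A, w (σ r) := fun i =>
      Finset.prod_congr rfl fun r hrA => by rw [Function.update_of_ne (hr r hrA)]
    have hT : ∀ i, ∏ x ∈ T, m (Function.update σ (reg (ι b)) i (reg x))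
        (Function.update σ (reg (ι b)) i (reg (ι x))) =
        ∏ x ∈ T, m (σ (reg x)) (σ (reg (ι x))) := fun i =>
      Finset.prod_congr rfl fun x hx => by
        rw [Function.update_of_ne (hr _ (h.reg_mem x hx).1),
          Function.update_of_ne (hr _ (h.reg_mem x hx).2)]
    simp only [Finset.prod_insert hb', Finset.prod_insert hbT, hA, hT, Function.update_self,
      Function.update_of_ne (hr _ hb), Function.update_of_ne (hr _ h.root_mem)]
    rw [← hm (σ (reg b))]
    ring

end IsSubtree

theorem sum_card_fibers {α β : Type*} [Fintype α] [Fintype β] [DecidableEq β] (g : α → β) :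
    ∑ r, ((Finset.univ.filter fun b => g b = r).card : ℤ) = Fintype.card α := by
  rw [← Nat.cast_sum, ← Finset.card_univ, Finset.card_eq_sum_card_fiberwise (s := Finset.univ)
    (t := Finset.univ) (f := g) (fun _ _ => Finset.mem_coe.2 (Finset.mem_univ _))]

theorem prod_zpow_eq_zpow_sum {α : Type*} {y : ℂ} (hy : y ≠ 0) (s : Finset α) (χ : α → ℤ) :
    ∏ f ∈ s, y ^ χ f = y ^ ∑ f ∈ s, χ f := by
  classical
  induction s using Finset.induction with
  | empty => simp
  | insert a s ha ih => rw [Finset.prod_insert ha, Finset.sum_insert ha, ih, zpow_add₀ hy]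

/-- The weight of a colouring of the regions of a smoothed diagram, computed from the faces and
the bands that join them. -/
theorem prod_region_weights {V F R : Type*} [Fintype V] [Fintype F] [Fintype R] [DecidableEq R] (p : F → R)
    (e : V → R) (χ : F → ℤ) {Y : Bool → ℂ} (hY : ∀ i, Y i ≠ 0) (σ : R → Bool) :
    ∏ r, Y (σ r) ^ (∑ f with p f = r, χ f - ((Finset.univ.filter fun v => e v = r).card : ℤ)) =
      (∏ f, Y (σ (p f)) ^ χ f) * ∏ v, (Y (σ (e v)))⁻¹ := by
  rw [← Finset.prod_fiberwise (s := Finset.univ) (g := p) (f := fun f => Y (σ (p f)) ^ χ f),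
    ← Finset.prod_fiberwise (s := Finset.univ) (g := e) (f := fun v => (Y (σ (e v)))⁻¹),
    ← Finset.prod_mul_distrib]
  refine Finset.prod_congr rfl fun r _ => ?_
  rw [Finset.prod_congr rfl (g := fun f => Y (σ r) ^ χ f)
      (fun f hf => by rw [(Finset.mem_filter.1 hf).2]),
    Finset.prod_congr rfl (s₁ := Finset.univ.filter fun v => e v = r)
      (g := fun _ => (Y (σ r))⁻¹) (fun v hv => by rw [(Finset.mem_filter.1 hv).2]), Finset.prod_const,
    prod_zpow_eq_zpow_sum (hY _), zpow_sub₀ (hY _), zpow_natCast, inv_pow, div_eq_mul_inv]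

open Classical in
/-- If a connected graph has Euler characteristic at least one, witnessed by vertex weights
`χ r ≤ 2 - deg r` of sum two, then it is a tree, and the sum over its independent sets that contain
a given vertex does not depend on the vertex. -/
theorem sum_independent_sets {B R : Type*} [Fintype B] [Fintype R] [DecidableEq R] {ι : B → B} {reg : B → R}
    (hι : ∀ b, ι (ι b) = b) (hne : ∀ b, ι b ≠ b)
    (hconn : ∀ r r', Relation.ReflTransGen (fun x y => ∃ b, reg b = x ∧ reg (ι b) = y) r r')
    {χ : R → ℤ} (hsum : ∑ r, χ r = 2)
    (hle : ∀ r, χ r + ((Finset.univ.filter fun b => reg b = r).card : ℤ) ≤ 2)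
    {Y : Bool → ℂ} (hY : Y false = 1) (hY0 : Y true ≠ 0) (hY1 : Y true ^ 2 + Y true = 1) (r₀ : R) :
    ∑ σ : R → Bool, (if σ r₀ = true then 1 else 0) *
      ((if ∀ b, ¬ (σ (reg b) = true ∧ σ (reg (ι b)) = true) then 1 else 0) *
        ∏ r, Y (σ r) ^ χ r) =
    Y true ^ 2 * (Y true)⁻¹ ^ (Fintype.card R - 1) := by
  obtain ⟨T, hT⟩ := IsSubtree.exists_univ hconn r₀
  have hcard := hT.card_eq
  rw [Finset.card_univ] at hcard
  have hdisj := hT.disjoint_image hι hne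
  have himg : (T.image ι).card = T.card :=
    Finset.card_image_of_injective _ (Function.LeftInverse.injective hι)
  have hdeg : ∑ r, ((Finset.univ.filter fun b => reg b = r).card : ℤ) = Fintype.card B := sum_card_fibers reg
  -- Each edge has two ends in `B`, so this allows at most `#R - 1` edges. The spanning tree already
  -- uses that many: it contains all edges, and every inequality in `hle` is an equality.
  have hle' : (Fintype.card B : ℤ) + 2 ≤ 2 * Fintype.card R := by
    have := Finset.sum_le_sum fun r (_ : r ∈ Finset.univ) => hle r
    rw [Finset.sum_add_distrib, hsum, hdeg, Finset.sum_const, Finset.card_univ,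
      nsmul_eq_mul] at this
    linarith
  have huniv : T ∪ T.image ι = Finset.univ := by
    rw [← Finset.card_eq_iff_eq_univ]
    have h1 := (T ∪ T.image ι).card_le_univ
    rw [Finset.card_union_of_disjoint hdisj, himg] at h1 ⊢
    omega
  have hB : Fintype.card B = 2 * T.card := by
    rw [← Finset.card_univ, ← huniv, Finset.card_union_of_disjoint hdisj, himg, two_mul]
  have heq : ∀ r, χ r = 2 - ((Finset.univ.filter fun b => reg b = r).card : ℤ) := by
    have h0 : ∑ r, (2 - (χ r + ((Finset.univ.filter fun b => reg b = r).card : ℤ))) = 0 := by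
      rw [Finset.sum_sub_distrib, Finset.sum_add_distrib, hsum, hdeg, Finset.sum_const,
        Finset.card_univ, nsmul_eq_mul, hB, hcard]
      push_cast; ring
    intro r
    have := (Finset.sum_eq_zero_iff_of_nonneg fun r _ => sub_nonneg.2 (hle r)).1 h0 r
      (Finset.mem_univ r)
    linarith
  have hne0 : ∀ i, Y i ≠ 0 := by
    rintro (_ | _)
    · rw [hY]; exact one_ne_zero
    · exact hY0
  -- With `χ r = 2 - deg r`, the weight is `Y ^ 2` at each vertex and `Y⁻¹` at both ends of each
  -- edge; the edge also carries the prohibition of two black ends.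
  set m : Bool → Bool → ℂ :=
    fun i j => (if i = true ∧ j = true then 0 else 1) * ((Y i)⁻¹ * (Y j)⁻¹) with hm
  -- Beside a white vertex a leaf gives `y + 1`, beside a black one only the white colour remains
  -- and gives `y⁻¹`. These agree as `y ^ 2 + y = 1`.
  have hmsum : ∀ i, Y true ^ 2 * m i true + Y false ^ 2 * m i false = (Y true)⁻¹ := by
    rintro (_ | _)
    · simp only [hm, hY, Bool.false_eq_true, false_and, if_false]
      field_simp
      linear_combination hY1
    · simp [hm, hY]
  have key := hT.sum_colourings (w := fun i => Y i ^ 2) hmsum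
  rw [Finset.card_univ] at key
  have key' := mul_left_cancel₀ (pow_ne_zero _ (two_ne_zero' ℂ)) key
  rw [hcard, Nat.add_sub_cancel, ← key']
  refine Finset.sum_congr rfl fun σ _ => ?_
  congr 1
  have h1 : ∏ r, Y (σ r) ^ χ r = (∏ r, Y (σ r) ^ 2) * ∏ b, (Y (σ (reg b)))⁻¹ := by
    rw [← Finset.prod_fiberwise (s := Finset.univ) (g := reg) (f := fun b => (Y (σ (reg b)))⁻¹),
      ← Finset.prod_mul_distrib]
    refine Finset.prod_congr rfl fun r _ => ?_
    rw [Finset.prod_congr rfl (g := fun _ => (Y (σ r))⁻¹)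
      (fun b hb => by rw [(Finset.mem_filter.1 hb).2]), Finset.prod_const, heq,
      zpow_sub₀ (hne0 _), zpow_natCast, inv_pow, div_eq_mul_inv]
    norm_cast
  have h2 : ∏ b, (Y (σ (reg b)))⁻¹ = ∏ b ∈ T, ((Y (σ (reg b)))⁻¹ * (Y (σ (reg (ι b))))⁻¹) := by
    rw [← huniv, Finset.prod_union hdisj, Finset.prod_image
      (Function.LeftInverse.injective hι).injOn, Finset.prod_mul_distrib]
  have h3 : (∏ b ∈ T, (if σ (reg b) = true ∧ σ (reg (ι b)) = true then (0 : ℂ) else 1)) =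
      if ∀ b, ¬ (σ (reg b) = true ∧ σ (reg (ι b)) = true) then 1 else 0 := by
    split_ifs with h
    · exact Finset.prod_eq_one fun b _ => if_neg (h b)
    · push Not at h
      obtain ⟨b, hb, hb'⟩ := h
      have : b ∈ T ∪ T.image ι := huniv ▸ Finset.mem_univ b
      rcases Finset.mem_union.1 this with k | k
      · exact Finset.prod_eq_zero k (if_pos ⟨hb, hb'⟩)
      · obtain ⟨x, hx, rfl⟩ := Finset.mem_image.1 k
        rw [hι] at hb'
        exact Finset.prod_eq_zero hx (if_pos ⟨hb', hb⟩)
  rw [h1, h2, ← h3]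
  simp only [hm, Finset.prod_mul_distrib]
  ring

/-! ### The state sum of a complete smoothing. -/

open Classical in
/-- The state sum of a complete smoothing of a diagram does not depend on the face that is required
to be black. -/
theorem exists_smoothing_sum {V M F : Type*} [Fintype V] [Finite M] [Fintype F]
    {Φ τ ι : Equiv.Perm M} {c : M → F} {a b : V → M} {χ : F → ℤ} {Y : Bool → ℂ}
    (hc : ∀ m, c (Φ m) = c m)
    (hne : ∀ v w, v ≠ w → a v ≠ a w ∧ a v ≠ b w ∧ b v ≠ b w)
    (hχ : ∀ f, χ f = 2 - ((Equiv.Perm.SameCycle.setoid Φ).numClasses (c ⁻¹' {f}) : ℤ))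
    (hτ : ∀ v, τ (a v) = b v ∧ τ (b v) = a v)
    (hτ' : ∀ m, (∀ v, m ≠ a v ∧ m ≠ b v) → τ m = m)
    (hι : ∀ m, ι (ι m) = m) (hιne : ∀ m, ι m ≠ m) (hψι : ∀ m, τ (Φ m) ≠ ι m)
    (hconj : ι * (τ * Φ) * ι⁻¹ = (τ * Φ)⁻¹)
    (hconn : ∀ f g, Relation.ReflTransGen (fun f g => ∃ m, c m = f ∧ c (ι m) = g) f g)
    (hsum : ∑ f, χ f = Fintype.card V + 2)
    (hY : Y false = 1) (hY0 : Y true ≠ 0) (hY1 : Y true ^ 2 + Y true = 1) :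
    ∃ z : ℂ, ∀ f₀ : F, ∑ σ : F → Bool, (if σ f₀ = true then 1 else 0) *
      ((if ∀ m, ¬ (σ (c m) = true ∧ σ (c (ι m)) = true) then 1 else 0) *
        ((∏ f, Y (σ f) ^ χ f) *
          ∏ v, if σ (c (a v)) = σ (c (b v)) then (Y (σ (c (a v))))⁻¹ else 0)) = z := by
  obtain ⟨s, hs1, hs2, hs3, hs4⟩ := exists_setoid_of_bands hc hne χ hχ Finset.univ τ
    (fun v _ => hτ v) (fun m hm => hτ' m fun v => hm v (Finset.mem_univ v))
  set ψ := τ * Φ with hψ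
  have hsc : Equiv.Perm.SameCycle.setoid ψ ≤ s.comap c :=
    Equiv.Perm.SameCycle.setoid_le fun x => by
      rw [Setoid.comap_rel]
      have := hs3 (Φ x)
      rw [hc] at this
      exact s.symm this
  -- The cycles of `ψ` are the sides of the smoothed curves: `reg` gives the region on a side, `ιB`
  -- the opposite side.
  let reg : Quotient (Equiv.Perm.SameCycle.setoid ψ) → Quotient s :=
    Quotient.map c fun _ _ h => hsc h
  let ιB : Quotient (Equiv.Perm.SameCycle.setoid ψ) → Quotient (Equiv.Perm.SameCycle.setoid ψ) :=
    Quotient.map ι fun x y h => by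
      have := Equiv.Perm.SameCycle.conj (g := ι) h
      rw [hconj] at this
      exact Equiv.Perm.sameCycle_inv.1 this
  have : Fintype (Quotient (Equiv.Perm.SameCycle.setoid ψ)) := Fintype.ofFinite _
  let χR : Quotient s → ℤ := fun r => ∑ f with Quotient.mk s f = r, χ f -
    ((Finset.univ.filter fun v => Quotient.mk s (c (a v)) = r).card : ℤ)
  have hιB : ∀ q, ιB (ιB q) = q := by
    intro q
    induction q using Quotient.inductionOn
    exact congrArg _ (hι _)
  have hιBne : ∀ q, ιB q ≠ q := by
    intro q
    induction q using Quotient.inductionOn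
    rename_i m
    intro h
    exact Equiv.Perm.not_sameCycle_of_involution hιne hψι hconj m
      (Equiv.Perm.SameCycle.symm (Quotient.exact h))
  have hconnR : ∀ r r',
      Relation.ReflTransGen (fun x y => ∃ b, reg b = x ∧ reg (ιB b) = y) r r' := by
    intro r r'
    induction r using Quotient.inductionOn
    induction r' using Quotient.inductionOn
    rename_i f g
    refine Relation.ReflTransGen.lift (Quotient.mk s) ?_ _ _ (hconn f g)
    rintro _ _ ⟨m, rfl, rfl⟩
    exact ⟨Quotient.mk _ m, rfl, rfl⟩
  have hsumR : ∑ r, χR r = 2 := by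
    have h1 : ∑ r, ∑ f with Quotient.mk s f = r, χ f = ∑ f, χ f :=
      Finset.sum_fiberwise _ _ _
    have h2 : ∑ r, ((Finset.univ.filter fun v => Quotient.mk s (c (a v)) = r).card : ℤ) =
        Fintype.card V := sum_card_fibers _
    simp only [χR, Finset.sum_sub_distrib, h1, h2, hsum]
    ring
  have hleR : ∀ r, χR r + ((Finset.univ.filter fun q => reg q = r).card : ℤ) ≤ 2 := by
    intro r
    induction r using Quotient.inductionOn
    rename_i f₀
    have h1 := hs4 f₀
    have h2 : (Equiv.Perm.SameCycle.setoid ψ).numClasses (c ⁻¹' {f | s f f₀}) =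
        (Finset.univ.filter fun q => reg q = Quotient.mk s f₀).card := by
      rw [Setoid.numClasses, ← Set.ncard_coe_finset]
      congr 1
      ext q
      induction q using Quotient.inductionOn
      rename_i m
      simp only [Finset.coe_filter, Finset.mem_univ, true_and, Set.mem_ofPred_eq]
      constructor
      · rintro ⟨x, hx, hxm⟩
        rw [← hxm]
        exact Quotient.sound hx
      · intro h
        exact ⟨m, Quotient.exact h, rfl⟩
    rw [h2] at h1
    simp only [χR, Quotient.eq]
    exact h1
  refine ⟨_, fun f₀ => (Eq.trans ?_ (sum_independent_sets hιB hιBne hconnR hsumR hleR hY hY0 hY1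
    (Quotient.mk s f₀)))⟩
  have hne0 : ∀ i, Y i ≠ 0 := by
    rintro (_ | _)
    · rw [hY]; exact one_ne_zero
    · exact hY0
  symm
  -- Colourings of the faces that come from the regions give equal terms; any other colouring
  -- violates some band and contributes zero.
  refine Finset.sum_of_injOn (fun σ f => σ (Quotient.mk s f)) ?_ (fun _ _ => by simp) ?_ ?_
  · intro σ _ σ' _ h
    funext r
    induction r using Quotient.inductionOn
    exact congrFun h _
  · intro σ _ hσ
    by_cases h : ∀ v, σ (c (a v)) = σ (c (b v))
    · exact absurd ⟨Quotient.lift σ (fun f g => hs2 σ (fun v _ => h v) f g), by simp, rfl⟩ hσ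
    · push Not at h
      obtain ⟨v, hv⟩ := h
      rw [Finset.prod_eq_zero (Finset.mem_univ v) (if_neg hv)]
      simp
  · intro σ _
    have h1 : (∀ q, ¬ (σ (reg q) = true ∧ σ (reg (ιB q)) = true)) ↔
        ∀ m, ¬ (σ (Quotient.mk s (c m)) = true ∧ σ (Quotient.mk s (c (ι m))) = true) :=
      Quotient.forall
    have h2 : ∏ r, Y (σ r) ^ χR r = (∏ f, Y (σ (Quotient.mk s f)) ^ χ f) *
        ∏ v, (Y (σ (Quotient.mk s (c (a v)))))⁻¹ :=
      prod_region_weights (Quotient.mk s) (fun v => Quotient.mk s (c (a v))) χ hne0 σ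
    have h3 : ∀ v, (if σ (Quotient.mk s (c (a v))) = σ (Quotient.mk s (c (b v))) then
        (Y (σ (Quotient.mk s (c (a v)))))⁻¹ else 0) = (Y (σ (Quotient.mk s (c (a v)))))⁻¹ :=
      fun v => if_pos (congrArg σ (Quotient.sound (hs1 v (Finset.mem_univ v))))
    simp only [h1, h2, h3]

/-! ### Marked points and boundary curves of a diagram. -/

namespace LinkDiagram

variable {V C F : Type*} (D : LinkDiagram V C F)

/-- The marked points on the boundary curves of the faces: one at each corner, and one on each
side of a crossingless curve. -/
abbrev Mark (V C : Type*) : Type _ := HalfEdge V ⊕ (C × Bool)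

/-- The face on whose boundary a marked point lies. -/
def markFace : Mark V C → F := Sum.elim D.cornerFace fun x => D.circleFace x.1 x.2

/-- The next marked point on the same boundary curve. -/
def next : Equiv.Perm (Mark V C) where
  toFun := Sum.map (fun h => turn (D.opp h)) id
  invFun := Sum.map (fun h => D.opp (h.1, h.2 - 1)) id
  left_inv := by
    rintro (h | x)
    · simp [turn, D.opp_opp]
    · rfl
  right_inv := by
    rintro (h | x)
    · simp [turn, D.opp_opp]
    · rfl

/-- The marked point on the other side of the same edge or crossingless curve. -/
def across : Equiv.Perm (Mark V C) :=
  Function.Involutive.toPerm (Sum.map D.opp fun x => (x.1, !x.2)) <| by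
    rintro (h | x)
    · simp [D.opp_opp]
    · simp

/-- A smoothing joins the east and west corners of a crossing (`true`) or the north and
south corners (`false`). This exchanges the two corners that are joined. -/
def joinCorner (t : Bool) (i : Fin 4) : Fin 4 := if decide (i.val % 2 = 0) = t then i + 2 else i

theorem joinCorner_joinCorner : ∀ t i, joinCorner t (joinCorner t i) = i := by decide

theorem joinCorner_rotate : ∀ t i, joinCorner t (joinCorner t (i + 1) + 1) = i := by decide

theorem joinCorner_rotate_ne : ∀ t i, joinCorner t (i + 1) ≠ i := by decide

/-- The exchange of the joined corners for a choice of smoothings. -/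
def join (t : V → Bool) : Equiv.Perm (Mark V C) :=
  Function.Involutive.toPerm (Sum.map (fun h => (h.1, joinCorner (t h.1) h.2)) id) <| by
    rintro (h | x)
    · simp [joinCorner_joinCorner]
    · rfl

@[simp] theorem next_inl (h : HalfEdge V) : D.next (.inl h) = .inl (turn (D.opp h)) := rfl
@[simp] theorem next_inr (x : C × Bool) : D.next (.inr x) = .inr x := rfl
@[simp] theorem across_inl (h : HalfEdge V) : D.across (.inl h) = .inl (D.opp h) := rfl
@[simp] theorem across_inr (x : C × Bool) : D.across (.inr x) = .inr (x.1, !x.2) := rfl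
@[simp] theorem join_inl (t : V → Bool) (h : HalfEdge V) :
    join (C := C) t (.inl h) = .inl (h.1, joinCorner (t h.1) h.2) := rfl
@[simp] theorem join_inr (t : V → Bool) (x : C × Bool) :
    join (V := V) t (.inr x) = .inr x := rfl

theorem markFace_next (m : Mark V C) : D.markFace (D.next m) = D.markFace m := by
  rcases m with h | x
  · exact D.cornerFace_walk h
  · rfl

theorem across_across (m : Mark V C) : D.across (D.across m) = m := by
  rcases m with h | x
  · simp [D.opp_opp]
  · simp

theorem across_ne (m : Mark V C) : D.across m ≠ m := by
  rcases m with h | x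
  · simpa using D.opp_ne h
  · simp [Prod.ext_iff]

/-- Together with `across_conj`, this supplies what `not_sameCycle_of_involution` needs. Both reduce
to finite checks on the four corners. -/
theorem join_next_ne (t : V → Bool) (m : Mark V C) : join t (D.next m) ≠ D.across m := by
  rcases m with h | x
  · simp [turn, Prod.ext_iff, joinCorner_rotate_ne]
  · simp [Prod.ext_iff]

/-- Seen from its other side, a smoothed curve is traversed backwards. -/
theorem across_conj (t : V → Bool) :
    D.across * (join t * D.next) * D.across⁻¹ = (join t * D.next)⁻¹ := by
  have key : ∀ m, D.across (join t (D.next (D.across (join t (D.next m))))) = m := by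
    rintro (h | x)
    · simp [turn, D.opp_opp, joinCorner_rotate]
    · simp
  have hinv : D.across⁻¹ = D.across := by
    rw [inv_eq_iff_mul_eq_one]
    exact Equiv.ext D.across_across
  rw [hinv, eq_inv_iff_mul_eq_one]
  exact Equiv.ext key

theorem adj_iff (f g : F) :
    D.Adj f g ↔ ∃ m : Mark V C, D.markFace m = f ∧ D.markFace (D.across m) = g := by
  have hopp : ∀ h, D.cornerFace (D.opp h) = D.cornerFace (turn h) := fun h => by
    rw [← D.cornerFace_walk (D.opp h), D.opp_opp]
  constructor
  · rintro (⟨h, h1, h2⟩ | ⟨c, b, h1, h2⟩)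
    · exact ⟨.inl h, h1, (hopp h).trans h2⟩
    · exact ⟨.inr (c, b), h1, h2⟩
  · rintro ⟨h | ⟨c, b⟩, h1, h2⟩
    · exact Or.inl ⟨h, h1, (hopp h).symm.trans h2⟩
    · exact Or.inr ⟨c, b, h1, h2⟩

theorem not_forbidden_iff (σ : F → Bool) : ¬ D.Forbidden σ ↔
    ∀ m : Mark V C, ¬ (σ (D.markFace m) = true ∧ σ (D.markFace (D.across m)) = true) := by
  constructor
  · rintro h m ⟨h1, h2⟩
    exact h ⟨_, _, (D.adj_iff _ _).2 ⟨m, rfl, rfl⟩, h1, h2⟩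
  · rintro h ⟨f, g, hfg, h1, h2⟩
    obtain ⟨m, rfl, rfl⟩ := (D.adj_iff _ _).1 hfg
    exact h m ⟨h1, h2⟩

/-- The cycles of `next` are the boundary walks together with one fixed point for each side of a
crossingless curve. -/
theorem eulerChar_eq [Finite V] [Finite C] (f : F) : D.eulerChar f =
    2 - ((Equiv.Perm.SameCycle.setoid D.next).numClasses (D.markFace ⁻¹' {f}) : ℤ) := by
  let j : Mark V C → D.Walk ⊕ (C × Bool) := Sum.map (Quot.mk _) id
  have hj : Equiv.Perm.SameCycle.setoid D.next ≤ Setoid.ker j :=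
    Equiv.Perm.SameCycle.setoid_le fun x => by
      rcases x with h | x
      · exact congrArg Sum.inl (Quot.sound rfl)
      · rfl
  let l : Quotient (Equiv.Perm.SameCycle.setoid D.next) → D.Walk ⊕ (C × Bool) :=
    Quotient.lift j fun _ _ h => hj h
  let i₁ : D.Walk → Quotient (Equiv.Perm.SameCycle.setoid D.next) :=
    Quot.lift (fun h => Quotient.mk _ (.inl h)) (by
      rintro h _ rfl
      exact Quotient.sound ⟨1, by simp⟩)
  let r : D.Walk ⊕ (C × Bool) → Quotient (Equiv.Perm.SameCycle.setoid D.next) :=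
    Sum.elim i₁ fun x => Quotient.mk _ (.inr x)
  have hlr : Function.LeftInverse r l := by
    intro q
    induction q using Quotient.inductionOn
    rename_i m
    rcases m with h | x <;> rfl
  have himg : l '' (Quotient.mk _ '' (D.markFace ⁻¹' {f})) =
      Sum.inl '' {w : D.Walk | D.walkFace w = f} ∪
        Sum.inr '' {s : C × Bool | D.circleFace s.1 s.2 = f} := by
    ext q
    constructor
    · rintro ⟨_, ⟨h | x, hm, rfl⟩, rfl⟩
      · exact Or.inl ⟨Quot.mk _ h, hm, rfl⟩
      · exact Or.inr ⟨x, hm, rfl⟩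
    · rintro (⟨w, hw, rfl⟩ | ⟨x, hx, rfl⟩)
      · induction w using Quot.inductionOn
        rename_i h
        exact ⟨_, ⟨.inl h, hw, rfl⟩, rfl⟩
      · exact ⟨_, ⟨.inr x, hx, rfl⟩, rfl⟩
  have : Finite D.Walk := inferInstanceAs (Finite (Quot _))
  unfold Setoid.numClasses
  rw [← hlr.injective.injOn.ncard_image, himg, Set.ncard_union_eq _ (Set.toFinite _)
      (Set.toFinite _), Sum.inl_injective.injOn.ncard_image, Sum.inr_injective.injOn.ncard_image,
    eulerChar, Nat.cast_add]
  rw [Set.disjoint_left]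
  rintro _ ⟨w, -, rfl⟩ ⟨x, -, h⟩
  cases h

/-- The sum is `2 * #F - #Walk - 2 * #C`; the two Euler formulas eliminate `#F` and then the number
of pieces. -/
theorem sum_eulerChar [Fintype V] [Fintype C] [Fintype F] (hD : D.IsSpherical) :
    ∑ f, D.eulerChar f = Fintype.card V + 2 := by
  classical
  have : Finite D.Walk := inferInstanceAs (Finite (Quot _))
  have : Fintype D.Walk := Fintype.ofFinite _
  have h1 := sum_card_fibers D.walkFace
  have h2 := sum_card_fibers fun s : C × Bool => D.circleFace s.1 s.2
  have e1 := hD.euler_pieces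
  have e2 := hD.euler_faces
  simp only [eulerChar, Finset.sum_sub_distrib, Finset.sum_add_distrib,
    Set.ncard_eq_toFinset_card', Set.toFinset_ofPred, h1, h2]
  simp only [Nat.card_eq_fintype_card (α := V), Nat.card_eq_fintype_card (α := C),
    Nat.card_eq_fintype_card (α := F), Nat.card_eq_fintype_card (α := D.Walk)] at e1 e2
  rw [Fintype.card_prod, Fintype.card_bool, Finset.sum_const, Finset.card_univ, nsmul_eq_mul]
  push_cast
  omega

end LinkDiagram

/-! ### Identities at a fifth root of unity and the skein relation. -/

theorem uFaceVar_true_sq_add {u : ℂ} (hu : IsPrimitiveRoot u 5) :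
    uFaceVar u true ^ 2 + uFaceVar u true = 1 := by
  have h := hu.geom_sum_eq_zero (by norm_num)
  simp only [Finset.sum_range_succ, Finset.sum_range_zero] at h
  have h5 := hu.pow_eq_one
  simp only [uFaceVar]
  linear_combination h + (2 + u) * h5

theorem uFaceVar_true_ne_zero {u : ℂ} (hu : IsPrimitiveRoot u 5) : uFaceVar u true ≠ 0 := by
  intro h
  have := uFaceVar_true_sq_add hu
  rw [h] at this
  norm_num at this

/-- The coefficients of the two smoothings of a crossing. -/
def smoothingCoeff (u : ℂ) : Bool → ℂ
  | true => -u ^ 3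
  | false => -u ^ 2

/-- The skein relation: on states without adjacent black faces, a crossing is a combination of its
two smoothings. -/
theorem uCrossingVar_eq_smoothings {u : ℂ} (hu : IsPrimitiveRoot u 5) {e n w s : Bool}
    (h1 : ¬ (e = true ∧ n = true)) (h2 : ¬ (n = true ∧ w = true)) (h3 : ¬ (w = true ∧ s = true))
    (h4 : ¬ (s = true ∧ e = true)) : uCrossingVar u e n w s =
      smoothingCoeff u true * (if e = w then (uFaceVar u e)⁻¹ else 0) +
        smoothingCoeff u false * (if n = s then (uFaceVar u n)⁻¹ else 0) := by
  have hinv : (uFaceVar u true)⁻¹ = uFaceVar u true + 1 := by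
    refine inv_eq_of_mul_eq_one_right ?_
    linear_combination uFaceVar_true_sq_add hu
  have hy : uFaceVar u true = u ^ 2 + u ^ 3 := rfl
  have hw : uFaceVar u false = 1 := rfl
  have h := hu.geom_sum_eq_zero (by norm_num)
  simp only [Finset.sum_range_succ, Finset.sum_range_zero] at h
  have h5 := hu.pow_eq_one
  -- Three colourings survive simplification: all white, and those with two opposite black corners,
  -- where `y⁻¹ = y + 1` is used.
  cases e <;> cases n <;> cases w <;> cases s <;>
    simp_all [uCrossingVar, smoothingCoeff]
  · ring
  · linear_combination h + h5
  · linear_combination h + (1 + u) * h5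

/-! ### Expansion of the invariant over smoothings. -/

namespace LinkDiagram

variable {V C F : Type*} (D : LinkDiagram V C F)

open Classical in
/-- The value on a black dot, with the facial factor of the dotted face put back. -/
theorem facial_mul_uValue [Fintype V] [Fintype F] (u : ℂ) (f : F) :
    uFaceVar u true ^ D.eulerChar f * D.uValue u (blackDot f) =
      ∑ σ : F → Bool, (if σ f = true then 1 else 0) *
        ((if ∀ m : Mark V C, ¬ (σ (D.markFace m) = true ∧ σ (D.markFace (D.across m)) = true)
            then 1 else 0) *
          ((∏ g, uFaceVar u (σ g) ^ D.eulerChar g) *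
            ∏ v : V, uCrossingVar u (σ (D.cornerFace (v, 0))) (σ (D.cornerFace (v, 1)))
              (σ (D.cornerFace (v, 2))) (σ (D.cornerFace (v, 3))))) := by
  have hρ : ∀ σ : F → Bool, (∀ g s, blackDot f g s → σ g = s) ↔ σ f = true := by
    intro σ
    constructor
    · exact fun h => h f true ⟨rfl, rfl⟩
    · rintro h g s ⟨rfl, rfl⟩; exact h
  have hdot : (Finset.univ.filter fun g => ¬ ∃ s, blackDot f g s) = Finset.univ.erase f := by
    ext g; simp [blackDot]
  unfold uValue
  simp only [hρ, hdot, D.not_forbidden_iff]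
  rw [Finset.mul_sum, Finset.sum_filter]
  refine Finset.sum_congr rfl fun σ _ => ?_
  by_cases h : σ f = true
  · rw [← Finset.mul_prod_erase Finset.univ _ (Finset.mem_univ f), h]
    simp only [true_and, if_true, one_mul]
    split_ifs <;> ring
  · simp [h]

open Classical in
/-- The sum over the states that are black in `f` of a diagram whose crossings are smoothed as `t`
says. The band at a smoothed crossing contributes an Euler characteristic of `-1`. -/
noncomputable def smoothingValue [Fintype V] [Fintype F] (u : ℂ) (t : V → Bool) (f : F) : ℂ :=
  ∑ σ : F → Bool, (if σ f = true then 1 else 0) *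
    ((if ∀ m : Mark V C, ¬ (σ (D.markFace m) = true ∧ σ (D.markFace (D.across m)) = true)
        then 1 else 0) *
      ((∏ g, uFaceVar u (σ g) ^ D.eulerChar g) *
        ∏ v : V, if σ (D.cornerFace (v, cond (t v) 0 1)) =
            σ (D.cornerFace (v, cond (t v) 2 3)) then
          (uFaceVar u (σ (D.cornerFace (v, cond (t v) 0 1))))⁻¹ else 0))

/-- The expansion of the state sum over all choices of smoothings. -/
theorem facial_mul_uValue_eq_sum [Fintype V] [DecidableEq V] [Fintype F] {u : ℂ} (hu : IsPrimitiveRoot u 5)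
    (f : F) : uFaceVar u true ^ D.eulerChar f * D.uValue u (blackDot f) =
      ∑ t : V → Bool, (∏ v, smoothingCoeff u (t v)) * D.smoothingValue u t f := by
  simp only [smoothingValue]
  rw [facial_mul_uValue]
  simp only [Finset.mul_sum]
  rw [Finset.sum_comm]
  refine Finset.sum_congr rfl fun σ _ => ?_
  -- The skein relation is needed only on states that are not forbidden; all other terms vanish on
  -- both sides.
  split_ifs with h1 h2
  · have hcross : ∀ v : V, uCrossingVar u (σ (D.cornerFace (v, 0))) (σ (D.cornerFace (v, 1)))
        (σ (D.cornerFace (v, 2))) (σ (D.cornerFace (v, 3))) =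
        ∑ i : Bool, smoothingCoeff u i * if σ (D.cornerFace (v, cond i 0 1)) =
            σ (D.cornerFace (v, cond i 2 3)) then
          (uFaceVar u (σ (D.cornerFace (v, cond i 0 1))))⁻¹ else 0 := by
      intro v
      have hadj : ∀ i, ¬ (σ (D.cornerFace (v, i)) = true ∧ σ (D.cornerFace (v, i + 1)) = true) :=
        fun i hi => (D.not_forbidden_iff σ).2 h2 ⟨_, _, Or.inl ⟨(v, i), rfl, rfl⟩, hi.1, hi.2⟩
      rw [Fintype.sum_bool]
      exact uCrossingVar_eq_smoothings hu (hadj 0) (hadj 1) (hadj 2) (hadj 3)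
    simp only [hcross, Finset.prod_univ_sum, Fintype.piFinset_univ, Finset.mul_sum,
      Finset.prod_mul_distrib]
    refine Finset.sum_congr rfl fun t _ => ?_
    ring
  all_goals simp

theorem exists_smoothingValue_eq [Fintype V] [Fintype C] [Fintype F] (hD : D.IsSpherical) {u : ℂ}
    (hu : IsPrimitiveRoot u 5) (t : V → Bool) :
    ∃ z : ℂ, ∀ f : F, D.smoothingValue u t f = z := by
  refine exists_smoothing_sum (Φ := D.next) (τ := join t) (ι := D.across) (c := D.markFace)
    (a := fun v => .inl (v, cond (t v) 0 1)) (b := fun v => .inl (v, cond (t v) 2 3))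
    D.markFace_next ?_ D.eulerChar_eq ?_ ?_ D.across_across D.across_ne (D.join_next_ne t)
    (D.across_conj t) ?_ (D.sum_eulerChar hD) rfl (uFaceVar_true_ne_zero hu)
    (uFaceVar_true_sq_add hu)
  · intro v w hvw
    simp [Prod.ext_iff, hvw]
  · intro v
    cases h : t v <;> simp [h, joinCorner]
  · rintro (⟨v, i⟩ | x) hm
    · have h := hm v
      cases ht : t v <;> rw [ht] at h <;> fin_cases i <;> simp_all [joinCorner]
    · rfl
  · intro f g
    refine Relation.ReflTransGen.mono ?_ _ _ (hD.connected f g)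
    exact fun f g h => (D.adj_iff f g).1 h

end LinkDiagram

theorem mainTheorem7 {V C F : Type*} [Fintype V] [Fintype C] [Fintype F]
    (u : ℂ) (hu : IsPrimitiveRoot u 5)
    (D : LinkDiagram V C F) (hD : D.IsSpherical) :
    (D.IsFine → ∀ f g : F, D.uValue u (blackDot f) = D.uValue u (blackDot g)) ∧
    (∀ f g : F,
      uFaceVar u true ^ D.eulerChar f * D.uValue u (blackDot f) =
        uFaceVar u true ^ D.eulerChar g * D.uValue u (blackDot g)) := by
  have main : ∀ f g : F,
      uFaceVar u true ^ D.eulerChar f * D.uValue u (blackDot f) =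
        uFaceVar u true ^ D.eulerChar g * D.uValue u (blackDot g) := by
    classical
    intro f g
    rw [D.facial_mul_uValue_eq_sum hu f, D.facial_mul_uValue_eq_sum hu g]
    refine Finset.sum_congr rfl fun t _ => ?_
    obtain ⟨z, hz⟩ := D.exists_smoothingValue_eq hD hu t
    rw [hz f, hz g]
  refine ⟨fun hfine f g => ?_, main⟩
  have h := main f g
  rw [hfine f, hfine g, zpow_one] at h
  exact mul_left_cancel₀ (uFaceVar_true_ne_zero hu) h
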